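/- Let $(R,\mathfrak m)$ be a complete Noetherian local ring with residue field $k$, let $E=E_R(k)$ be an injective hull of $k$, and write $M^\vee=\operatorname{Hom}_R(M,E)$. A closure operation $\mathrm{cl}$ on finitely generated $R$-modules assigns to each submodule $L$ of a finitely generated $R$-module $M$ a submodule $L^{\mathrm{cl}}_M$ with $L\subseteq L^{\mathrm{cl}}_M\subseteq M$, such that $(L^{\mathrm{cl}}_M)^{\mathrm{cl}}_M=L^{\mathrm{cl}}_M$, and $L^{\mathrm{cl}}_M\subseteq N^{\mathrm{cl}}_M$ whenever $L\subseteq N\subseteq M$. It is residual if $(\ker q)^{\mathrm{cl}}_M=q^{-1}(0^{\mathrm{cl}}_P)$ for every surjective $R$-linear map $q:M\to P$ of finitely generated modules. It is a Nakayama closure if, for all submodules $L\subseteq N$ of a finitely generated module $M$ with $N\subseteq (L+\mathfrak m N)^{\mathrm{cl}}_M$, one has $L^{\mathrm{cl}}_M=N^{\mathrm{cl}}_M$. An interior operation $\mathrm i$ on Artinian $R$-modules assigns to each Artinian module $A$ a submodule $\mathrm i(A)\subseteq A$, such that $\varphi(\mathrm i(A))=\mathrm i(B)$ for every isomorphism $\varphi:A\to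 B$, $\mathrm i(A)\subseteq \mathrm i(B)$ whenever $A\subseteq B$, and $\mathrm i(\mathrm i(A))=\mathrm i(A)$. It is a Nakayama interior if, for all Artinian modules $A\subseteq B$ with $\mathrm i(A:_B\mathfrak m)\subseteq A$, one has $\mathrm i(A)=\mathrm i(B)$, where $(A:_B\mathfrak m)=\{b\in B\mid \mathfrak m b\subseteq A\}$. Let $\mathrm{cl}$ be a residual closure operation on finitely generated $R$-modules. For each Artinian $R$-module $A$ (whose dual $A^\vee$ is finitely generated) put $$\mathrm i(A)=\left(\frac{A^\vee}{0^{\mathrm{cl}}_{A^\vee}}\right)^\vee,$$ regarded as a submodule of $A$ through the inclusion $\left(A^\vee/0^{\mathrm{cl}}_{A^\vee}\right)^\vee\hookrightarrow A^{\vee\vee}$ dual to the quotient map and the canonical isomorphism $A\cong A^{\vee\vee}$. Then $\mathrm i$ is an interior operation on Artinian $R$-modules, and $\mathrm{cl}$ is a Nakayama closure if and only if $\mathrm i$ is a Nakayama interior. -/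

import Mathlib

universe u

namespace ClosureInterior

open IsLocalRing

/-- `j : k → E` exhibits `E` as an injective hull of `k`: it is an essential monomorphism into an
injective module. -/
structure IsInjectiveHull {R : Type u} [CommRing R] {k E : Type u} [AddCommGroup k] [Module R k]
    [AddCommGroup E] [Module R E] (j : k →ₗ[R] E) : Prop where
  injective : Function.Injective j
  injectiveModule : Module.Injective R E
  essential : ∀ S : Submodule R E, S ⊓ LinearMap.range j = ⊥ → S = ⊥

/-- The dual `M^∨ = Hom_R(M, E)` (the Matlis dual when `E` is the injective hull of the residue
field). -/
abbrev MatlisDual (R : Type u) [CommRing R] (E : Type u) [AddCommGroup E] [Module R E]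
    (M : Type u) [AddCommGroup M] [Module R M] : Type u :=
  M →ₗ[R] E

/-- The colon submodule `(A :_B I) = {b ∈ B | I b ⊆ A}`. -/
def colonSubmodule {R : Type u} [CommRing R] {B : Type u} [AddCommGroup B] [Module R B]
    (A : Submodule R B) (I : Ideal R) : Submodule R B where
  carrier := {b | ∀ r ∈ I, r • b ∈ A}
  add_mem' ha hb r hr := by
    rw [smul_add]
    exact A.add_mem (ha r hr) (hb r hr)
  zero_mem' r _ := by simp
  smul_mem' c b hb r hr := by
    rw [smul_comm]
    exact A.smul_mem c (hb r hr)

/-- A closure operation on finitely generated `R`-modules: `cl M L` is `L^cl_M`. -/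
structure ClosureOperation (R : Type u) [CommRing R] where
  cl : ∀ (M : Type u) [AddCommGroup M] [Module R M] [Module.Finite R M],
    Submodule R M → Submodule R M
  le_cl : ∀ (M : Type u) [AddCommGroup M] [Module R M] [Module.Finite R M] (L : Submodule R M),
    L ≤ cl M L
  idempotent : ∀ (M : Type u) [AddCommGroup M] [Module R M] [Module.Finite R M]
    (L : Submodule R M), cl M (cl M L) = cl M L
  mono : ∀ (M : Type u) [AddCommGroup M] [Module R M] [Module.Finite R M] (L N : Submodule R M),
    L ≤ N → cl M L ≤ cl M N

/-- `cl` is residual: `(ker q)^cl_M = q⁻¹(0^cl_P)` for every surjection `q : M → P` of finitely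
generated modules. -/
def ClosureOperation.IsResidual {R : Type u} [CommRing R] (c : ClosureOperation R) : Prop :=
  ∀ (M P : Type u) [AddCommGroup M] [Module R M] [Module.Finite R M]
    [AddCommGroup P] [Module R P] [Module.Finite R P] (q : M →ₗ[R] P),
    Function.Surjective q → c.cl M (LinearMap.ker q) = (c.cl P ⊥).comap q

/-- `cl` is a Nakayama closure: `L ⊆ N ⊆ (L + 𝔪 N)^cl_M` implies `L^cl_M = N^cl_M`. -/
def ClosureOperation.IsNakayama {R : Type u} [CommRing R] [IsLocalRing R]
    (c : ClosureOperation R) : Prop :=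
  ∀ (M : Type u) [AddCommGroup M] [Module R M] [Module.Finite R M] (L N : Submodule R M),
    L ≤ N → N ≤ c.cl M (L ⊔ maximalIdeal R • N) → c.cl M L = c.cl M N

/-- An assignment of a submodule `i A ⊆ A` to every Artinian `R`-module `A`. -/
def ArtinianSelector (R : Type u) [CommRing R] : Type (u + 1) :=
  ∀ (A : Type u) [AddCommGroup A] [Module R A] [IsArtinian R A], Submodule R A

/-- `i` is an interior operation on Artinian modules. For a submodule `L ⊆ M`, the submodule
`i L` of `L` is regarded as a submodule of `M` by `Submodule.map L.subtype`. -/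
structure ArtinianSelector.IsInterior {R : Type u} [CommRing R] (i : ArtinianSelector R) :
    Prop where
  map_equiv : ∀ (M N : Type u) [AddCommGroup M] [Module R M] [IsArtinian R M]
    [AddCommGroup N] [Module R N] [IsArtinian R N] (φ : M ≃ₗ[R] N),
    (i M).map φ.toLinearMap = i N
  mono : ∀ (M : Type u) [AddCommGroup M] [Module R M] [IsArtinian R M] (L : Submodule R M),
    (i L).map L.subtype ≤ i M
  idempotent : ∀ (M : Type u) [AddCommGroup M] [Module R M] [IsArtinian R M],
    (i (i M)).map (i M).subtype = i M

/-- `i` is Nakayama: `i (A :_B 𝔪) ⊆ A` implies `i A = i B`, for Artinian modules `A ⊆ B`. -/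
def ArtinianSelector.IsNakayama {R : Type u} [CommRing R] [IsLocalRing R]
    (i : ArtinianSelector R) : Prop :=
  ∀ (B : Type u) [AddCommGroup B] [Module R B] [IsArtinian R B] (A : Submodule R B),
    (i (colonSubmodule A (maximalIdeal R))).map (colonSubmodule A (maximalIdeal R)).subtype ≤ A →
      (i A).map A.subtype = i B

section MatlisFinite

variable {R : Type u} [CommRing R] {E A : Type u} [AddCommGroup E] [Module R E]
  [AddCommGroup A] [Module R A]

lemma mem_ideal_smul_top_of_vanish [IsNoetherianRing R] (hE : Module.Injective R E) (I : Ideal R)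
    (f : A →ₗ[R] E) (hf : ∀ a ∈ colonSubmodule (⊥ : Submodule R A) I, f a = 0) :
    f ∈ I • (⊤ : Submodule R (A →ₗ[R] E)) := by
  classical
  obtain ⟨n, r, hr⟩ := Submodule.fg_iff_exists_fin_generating_family.mp
    (IsNoetherian.noetherian I)
  have hrI : ∀ t, r t ∈ I := fun t => hr ▸ Submodule.subset_span ⟨t, rfl⟩
  let φ : A →ₗ[R] (Fin n → A) := LinearMap.pi fun t => r t • LinearMap.id
  have hker : LinearMap.ker φ ≤ LinearMap.ker f := by
    intro a ha
    apply hf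
    intro s hs
    have ha' : ∀ t, r t • a = 0 := fun t => congrFun (LinearMap.mem_ker.mp ha) t
    have hle : I ≤ LinearMap.ker (LinearMap.toSpanSingleton R A a) := by
      rw [← hr, Submodule.span_le]
      rintro _ ⟨t, rfl⟩
      simpa using ha' t
    simpa using hle hs
  obtain ⟨g, hg⟩ := (Module.Baer.of_injective hE).extension_property
    ((LinearMap.ker φ).liftQ φ le_rfl)
    (LinearMap.ker_eq_bot.mp (Submodule.ker_liftQ_eq_bot _ _ _ le_rfl))
    ((LinearMap.ker φ).liftQ f hker)
  have hfg : f = ∑ t, r t • (g ∘ₗ LinearMap.single R (fun _ => A) t) := by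
    ext a
    have h1 : g (φ a) = f a := by
      simpa using LinearMap.congr_fun hg (Submodule.Quotient.mk a)
    rw [← h1, ← LinearMap.sum_single_apply (v := φ a)]
    simp [φ, LinearMap.sum_apply, Pi.single_smul]
  rw [hfg]
  exact Submodule.sum_mem _ fun t _ => Submodule.smul_mem_smul (hrI t) trivial

lemma vanish_of_mem_ideal_smul_top (I : Ideal R) (f : A →ₗ[R] E)
    (hf : f ∈ I • (⊤ : Submodule R (A →ₗ[R] E))) (a : A)
    (ha : a ∈ colonSubmodule (⊥ : Submodule R A) I) : f a = 0 := by
  induction hf using Submodule.smul_induction_on' with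
  | smul r hr g _ =>
    have : r • a = 0 := ha r hr
    rw [LinearMap.smul_apply, ← map_smul, this, map_zero]
  | add x _ y _ hx hy => rw [LinearMap.add_apply, hx, hy, add_zero]

lemma exists_pow_mem_colon [IsLocalRing R] [IsNoetherianRing R] [IsArtinian R A] (a : A) :
    ∃ n, a ∈ colonSubmodule (⊥ : Submodule R A) (maximalIdeal R ^ n) := by
  let c : ℕ →o (Submodule R A)ᵒᵈ :=
    ⟨fun n => OrderDual.toDual (maximalIdeal R ^ n • Submodule.span R {a}), fun m n h =>
      OrderDual.toDual_le_toDual.mpr (Submodule.smul_mono_left (Ideal.pow_le_pow_right h))⟩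
  obtain ⟨n, hn⟩ := IsArtinian.monotone_stabilizes c
  have h1 : maximalIdeal R ^ n • Submodule.span R {a} =
      maximalIdeal R ^ (n + 1) • Submodule.span R {a} := hn (n + 1) n.le_succ
  have h2 : maximalIdeal R ^ n • Submodule.span R {a} = ⊥ := by
    apply Submodule.eq_bot_of_le_smul_of_le_jacobson_bot (maximalIdeal R)
    · exact Submodule.FG.smul (IsNoetherian.noetherian _) (Submodule.fg_span_singleton a)
    · conv_lhs => rw [h1, pow_succ', Submodule.mul_smul]
    · exact (IsLocalRing.jacobson_eq_maximalIdeal ⊥ bot_ne_top).ge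
  refine ⟨n, fun r hr => ?_⟩
  rw [← h2]
  exact Submodule.smul_mem_smul hr (Submodule.mem_span_singleton_self a)

lemma finite_socle [IsLocalRing R] [IsArtinian R A] :
    Module.Finite R (colonSubmodule (⊥ : Submodule R A) (maximalIdeal R)) := by
  have hT : Module.IsTorsionBySet R (colonSubmodule (⊥ : Submodule R A) (maximalIdeal R))
      (maximalIdeal R : Set R) := by
    rintro ⟨a, ha⟩ ⟨r, hr⟩
    exact Subtype.ext (ha r hr)
  let := hT.module
  let : Field (R ⧸ maximalIdeal R) := Ideal.Quotient.field _
  have : IsSemisimpleModule R (colonSubmodule (⊥ : Submodule R A) (maximalIdeal R)) :=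
    hT.isSemisimpleModule_iff.mp
      (inferInstanceAs (IsSemisimpleModule (R ⧸ maximalIdeal R) _))
  have hA : IsArtinian R (colonSubmodule (⊥ : Submodule R A) (maximalIdeal R)) := inferInstance
  exact (IsSemisimpleModule.finite_tfae.out 2 0).mp hA

lemma isPrecomplete_pi (I : Ideal R) [IsPrecomplete I R] (n : ℕ) :
    IsPrecomplete I (Fin n → R) := by
  constructor
  intro f hf
  have hcoord : ∀ (m : ℕ) (x : Fin n → R), x ∈ (I ^ m • ⊤ : Submodule R (Fin n → R)) →
      ∀ t, x t ∈ (I ^ m • ⊤ : Submodule R R) := by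
    intro m x hx t
    have := Submodule.mem_map_of_mem (f := LinearMap.proj (R := R) (φ := fun _ : Fin n => R) t) hx
    rw [Submodule.map_smul''] at this
    exact Submodule.smul_mono le_rfl le_top this
  have hL : ∀ t, ∃ L : R, ∀ m, f m t ≡ L [SMOD (I ^ m • ⊤ : Submodule R R)] := by
    intro t
    apply IsPrecomplete.prec (inferInstance : IsPrecomplete I R)
    intro a b hab
    rw [SModEq.sub_mem]
    exact hcoord a _ (SModEq.sub_mem.mp (hf hab)) t
  choose L hL using hL
  refine ⟨L, fun m => ?_⟩
  rw [SModEq.sub_mem, pi_eq_sum_univ (f m - L)]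
  refine Submodule.sum_mem _ fun t _ => Submodule.smul_mem_smul ?_ trivial
  have := SModEq.sub_mem.mp (hL t m)
  simpa using this

/-- Over a complete Noetherian local ring the Matlis dual of an Artinian module is finitely
generated. -/
lemma finite_matlisDual [IsLocalRing R] [IsNoetherianRing R]
    [IsAdicComplete (maximalIdeal R) R] {j : ResidueField R →ₗ[R] E} (hj : IsInjectiveHull j)
    (A : Type u) [AddCommGroup A] [Module R A] [IsArtinian R A] :
    Module.Finite R (MatlisDual R E A) := by
  have hEs : IsNoetherian R (colonSubmodule (⊥ : Submodule R E) (maximalIdeal R)) := by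
    have hk : IsNoetherian R (ResidueField R) :=
      isNoetherian_of_surjective (Algebra.linearMap R (ResidueField R))
        (LinearMap.range_eq_top.mpr residue_surjective)
    have hr : IsNoetherian R (LinearMap.range j) := inferInstance
    refine isNoetherian_of_le (t := LinearMap.range j) fun x hx => ?_
    by_contra hxr
    have hx0 : Submodule.span R {x} ≠ ⊥ := by
      intro h
      rw [Submodule.span_singleton_eq_bot] at h
      exact hxr (h ▸ zero_mem _)
    obtain ⟨y, hy, hy0⟩ := Submodule.exists_mem_ne_zero_of_ne_bot (mt (hj.essential _) hx0)
    obtain ⟨hy1, hy2⟩ := hy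
    obtain ⟨r, rfl⟩ := Submodule.mem_span_singleton.mp hy1
    by_cases hrm : r ∈ maximalIdeal R
    · exact hy0 (hx r hrm)
    · have hu : IsUnit r := by simpa using hrm
      exact hxr ((Submodule.smul_mem_iff_of_isUnit _ hu).mp hy2)
  have hH : IsHausdorff (maximalIdeal R) (MatlisDual R E A) := by
    constructor
    intro f hf
    ext a
    obtain ⟨n, hn⟩ := exists_pow_mem_colon (R := R) a
    exact vanish_of_mem_ideal_smul_top _ f (SModEq.zero.mp (hf n)) a hn
  have hQ : Module.Finite R (MatlisDual R E A ⧸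
      (maximalIdeal R • ⊤ : Submodule R (MatlisDual R E A))) := by
    have := finite_socle (R := R) (A := A)
    obtain ⟨n, s, hs⟩ := Submodule.fg_iff_exists_fin_generating_family.mp
      (Module.Finite.iff_fg.mp this)
    have hsm : ∀ t, s t ∈ colonSubmodule (⊥ : Submodule R A) (maximalIdeal R) := fun t =>
      hs ▸ Submodule.subset_span ⟨t, rfl⟩
    let ev : MatlisDual R E A →ₗ[R]
        (Fin n → colonSubmodule (⊥ : Submodule R E) (maximalIdeal R)) :=
      LinearMap.pi fun t => LinearMap.codRestrict _ (LinearMap.applyₗ (s t)) fun f r hr => by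
        have h0 : r • s t = 0 := hsm t r hr
        simp [← map_smul, h0]
    have hev : LinearMap.ker ev ≤ maximalIdeal R • ⊤ := by
      intro f hf
      apply mem_ideal_smul_top_of_vanish hj.injectiveModule
      have hle : colonSubmodule (⊥ : Submodule R A) (maximalIdeal R) ≤ LinearMap.ker f := by
        rw [← hs, Submodule.span_le]
        rintro _ ⟨t, rfl⟩
        exact congrArg Subtype.val (congrFun (LinearMap.mem_ker.mp hf) t)
      exact fun a ha => hle ha
    have h1 : Module.Finite R (MatlisDual R E A ⧸ LinearMap.ker ev) :=
      Module.Finite.equiv ev.quotKerEquivRange.symm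
    exact Module.Finite.of_surjective (Submodule.factor hev) (Submodule.factor_surjective hev)
  obtain ⟨n, p, hp⟩ := Module.Finite.exists_fin' R (MatlisDual R E A ⧸
      (maximalIdeal R • ⊤ : Submodule R (MatlisDual R E A)))
  obtain ⟨q, hq⟩ := Module.projective_lifting_property
    (Submodule.mkQ (maximalIdeal R • ⊤ : Submodule R (MatlisDual R E A))) p
    (Submodule.mkQ_surjective _)
  have := isPrecomplete_pi (maximalIdeal R) n
  exact Module.Finite.of_surjective q
    (surjective_of_mkQ_comp_surjective (I := maximalIdeal R) (by rw [hq]; exact hp))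

end MatlisFinite

/-- The canonical map `A → A^∨∨`, `a ↦ (f ↦ f a)`. -/
def biduality (R : Type u) [CommRing R] (E : Type u) [AddCommGroup E] [Module R E]
    (A : Type u) [AddCommGroup A] [Module R A] :
    A →ₗ[R] MatlisDual R E (MatlisDual R E A) :=
  LinearMap.applyₗ

/-- The interior dual to `cl`: `i A = (A^∨ / 0^cl_{A^∨})^∨`, regarded as a submodule of `A`. The
quotient map `π : A^∨ → A^∨ / 0^cl_{A^∨}` induces the inclusion `π^∨` of `(A^∨ / 0^cl_{A^∨})^∨` in
`A^∨∨`, and its image is transported to `A` along the canonical map `A → A^∨∨`. -/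
noncomputable def dualInterior {R : Type u} [CommRing R] [IsLocalRing R] [IsNoetherianRing R]
    [IsAdicComplete (maximalIdeal R) R] {E : Type u} [AddCommGroup E] [Module R E]
    {j : ResidueField R →ₗ[R] E} (hj : IsInjectiveHull j) (c : ClosureOperation R) :
    ArtinianSelector R :=
  fun A _ _ _ =>
    haveI : Module.Finite R (MatlisDual R E A) := finite_matlisDual hj A
    (LinearMap.range
      (LinearMap.lcomp R E (c.cl (MatlisDual R E A) ⊥).mkQ)).comap (biduality R E A)

end ClosureInterior

/-!
Matlis duality makes `S ↦ {f | f = 0 on S}` an order-reversing bijection from the submodules of an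
Artinian module `A` to those of `A^∨`, and under it `(S :_A 𝔪)` corresponds to `𝔪 Z` when `S`
corresponds to `Z`. Because `cl` is residual, the submodule `i S ⊆ A` corresponds to `cl Z`. Hence
the axioms of an interior operation for `i` are those of a closure operation for `cl`, and `i` is
Nakayama exactly when `Z ⊆ cl (𝔪 Z)` implies `cl 0 = cl Z` for all submodules `Z` of duals of
Artinian modules. Up to isomorphism these duals are all the finitely generated modules, and
residuality, applied to `M → M / L`, reduces the general Nakayama property to this case `L = 0`.

Reflexivity rests on the single fact that every endomorphism of `E` is a homothety. It passes from
`R` to finite free modules, to their quotients, and from `A^∨` to `A`.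
-/

namespace ClosureInterior

open IsLocalRing

section DualAnnihilator

variable {R : Type u} [CommRing R] {E A B : Type u} [AddCommGroup E] [Module R E]
  [AddCommGroup A] [Module R A] [AddCommGroup B] [Module R B]

/-- The submodule of the maps in `A^∨ = Hom_R(A, E)` that vanish on `S`; this is the analogue for
`E`-valued duals of `Submodule.dualAnnihilator`. -/
def dualAnnihilator (E : Type u) [AddCommGroup E] [Module R E] (S : Submodule R A) :
    Submodule R (MatlisDual R E A) :=
  LinearMap.ker (LinearMap.lcomp R E S.subtype)

/-- The submodule of the elements of `A` killed by every map in `Z ⊆ A^∨`, encoded as the preimage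
of the annihilator of `Z` in `A^∨∨`; this is the analogue for `E`-valued duals of
`Submodule.dualCoannihilator`. -/
def dualCoannihilator (Z : Submodule R (MatlisDual R E A)) : Submodule R A :=
  (dualAnnihilator E Z).comap (biduality R E A)

lemma mem_dualAnnihilator {S : Submodule R A} {f : MatlisDual R E A} :
    f ∈ dualAnnihilator E S ↔ ∀ a ∈ S, f a = 0 := by
  simp [dualAnnihilator, LinearMap.ext_iff]

lemma mem_dualCoannihilator {Z : Submodule R (MatlisDual R E A)} {a : A} :
    a ∈ dualCoannihilator Z ↔ ∀ f ∈ Z, f a = 0 :=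
  mem_dualAnnihilator

lemma dualAnnihilator_gc : GaloisConnection
    (OrderDual.toDual ∘ (dualAnnihilator E : Submodule R A → Submodule R (MatlisDual R E A)))
    (dualCoannihilator ∘ OrderDual.ofDual) := by
  intro S Z
  simp only [Function.comp_apply, ← OrderDual.ofDual_le_ofDual, OrderDual.ofDual_toDual,
    SetLike.le_def, mem_dualAnnihilator, mem_dualCoannihilator]
  exact ⟨fun h a ha f hf => h hf a ha, fun h f hf a ha => h ha f hf⟩

lemma dualAnnihilator_range (φ : A →ₗ[R] B) :
    dualAnnihilator E (LinearMap.range φ) = LinearMap.ker (LinearMap.lcomp R E φ) := by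
  ext f
  simp [mem_dualAnnihilator, LinearMap.ext_iff]

lemma range_lcomp_mkQ (S : Submodule R A) :
    LinearMap.range (LinearMap.lcomp R E S.mkQ) = dualAnnihilator E S :=
  (LinearMap.exact_iff.mp (LinearMap.exact_lcomp_of_exact_of_surjective E
    (LinearMap.exact_subtype_mkQ S) S.mkQ_surjective)).symm

lemma dualCoannihilator_smul (I : Ideal R) (Z : Submodule R (MatlisDual R E A)) :
    dualCoannihilator (I • Z) = colonSubmodule (dualCoannihilator Z) I := by
  ext a
  calc a ∈ dualCoannihilator (I • Z)
      ↔ I • Z ≤ LinearMap.ker (biduality R E A a) := mem_dualCoannihilator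
    _ ↔ ∀ r ∈ I, ∀ f ∈ Z, f (r • a) = 0 := by
      simp only [Submodule.smul_le, LinearMap.mem_ker, map_smul]; rfl
    _ ↔ a ∈ colonSubmodule (dualCoannihilator Z) I :=
      forall₂_congr fun _ _ => mem_dualCoannihilator.symm

end DualAnnihilator

section InjectiveCogenerator

variable {R : Type u} [CommRing R] {E A B : Type u} [AddCommGroup E] [Module R E]
  [AddCommGroup A] [Module R A] [AddCommGroup B] [Module R B]

lemma lcomp_surjective_of_injective (hE : Module.Injective R E) {φ : A →ₗ[R] B}
    (hφ : Function.Injective φ) : Function.Surjective (LinearMap.lcomp R E φ) :=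
  (Module.Baer.of_injective hE).extension_property φ hφ

lemma exists_comp_eq_of_ker_le (hE : Module.Injective R E) {φ : A →ₗ[R] B} {g : A →ₗ[R] E}
    (h : LinearMap.ker φ ≤ LinearMap.ker g) : ∃ f : B →ₗ[R] E, f ∘ₗ φ = g := by
  obtain ⟨f, hf⟩ := lcomp_surjective_of_injective hE
    (LinearMap.ker_eq_bot.mp (Submodule.ker_liftQ_eq_bot _ φ le_rfl le_rfl))
    ((LinearMap.ker φ).liftQ g h)
  exact ⟨f, LinearMap.ext fun a => LinearMap.congr_fun hf (Submodule.Quotient.mk a)⟩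

/-- `E` is a cogenerator of the category of `R`-modules, in the form that maps to `E` detect nonzero
elements. Modules are restricted to the universe of `R`. -/
def IsCogenerator (R : Type u) [CommRing R] (E : Type u) [AddCommGroup E] [Module R E] : Prop :=
  ∀ ⦃M : Type u⦄ [AddCommGroup M] [Module R M] ⦃x : M⦄, x ≠ 0 → ∃ f : M →ₗ[R] E, f x ≠ 0

lemma IsCogenerator.biduality_injective (hE : IsCogenerator R E) :
    Function.Injective (biduality R E A) := by
  rw [injective_iff_map_eq_zero]
  intro a ha
  by_contra ha0
  obtain ⟨f, hf⟩ := hE ha0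
  exact hf (LinearMap.congr_fun ha f)

lemma IsCogenerator.dualCoannihilator_dualAnnihilator (hE : IsCogenerator R E)
    (S : Submodule R A) : dualCoannihilator (dualAnnihilator E S) = S := by
  refine le_antisymm (fun a ha => ?_) (dualAnnihilator_gc.le_u_l S)
  by_contra haS
  obtain ⟨f, hf⟩ := hE (mt (Submodule.Quotient.mk_eq_zero S).mp haS)
  have hfS : f ∘ₗ S.mkQ ∈ dualAnnihilator E S := range_lcomp_mkQ (E := E) S ▸ ⟨f, rfl⟩
  exact hf (mem_dualCoannihilator.mp ha _ hfS)

lemma IsCogenerator.dualAnnihilator_dualCoannihilator (hE : IsCogenerator R E)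
    (hA : Function.Surjective (biduality R E A)) (Z : Submodule R (MatlisDual R E A)) :
    dualAnnihilator E (dualCoannihilator Z) = Z := by
  refine le_antisymm (fun f hf => ?_) (dualAnnihilator_gc.l_u_le Z)
  rw [← hE.dualCoannihilator_dualAnnihilator Z, mem_dualCoannihilator, hA.forall]
  exact mem_dualAnnihilator.mp hf

lemma IsCogenerator.dualCoannihilator_le_iff (hE : IsCogenerator R E)
    (hA : Function.Surjective (biduality R E A)) {Y Z : Submodule R (MatlisDual R E A)} :
    dualCoannihilator Y ≤ dualCoannihilator Z ↔ Z ≤ Y := by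
  rw [← OrderDual.toDual_le_toDual]
  conv_rhs => rw [← hE.dualAnnihilator_dualCoannihilator hA Y]
  exact (dualAnnihilator_gc (E := E) _ (OrderDual.toDual Z)).symm

lemma IsCogenerator.isArtinian_of_isNoetherian_dual (hE : IsCogenerator R E)
    [IsNoetherian R (MatlisDual R E A)] : IsArtinian R A :=
  have hanti : Antitone (dualAnnihilator E : Submodule R A → _) := dualAnnihilator_gc.monotone_l
  (hanti.strictAnti_of_injective
    (Function.LeftInverse.injective hE.dualCoannihilator_dualAnnihilator)).wellFoundedLT

lemma IsCogenerator.map_dualCoannihilator (hE : IsCogenerator R E) (hinj : Module.Injective R E)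
    {φ : A →ₗ[R] B} (hφ : Function.Injective φ) (Z : Submodule R (MatlisDual R E A)) :
    (dualCoannihilator Z).map φ = dualCoannihilator (Z.comap (LinearMap.lcomp R E φ)) := by
  refine le_antisymm ?_ fun b hb => ?_
  · rintro _ ⟨a, ha, rfl⟩
    exact mem_dualCoannihilator.mpr fun f hf => mem_dualCoannihilator.mp ha _ hf
  · have hker : dualAnnihilator E (LinearMap.range φ) ≤ Z.comap (LinearMap.lcomp R E φ) :=
      (dualAnnihilator_range φ).trans_le (LinearMap.ker_le_comap _)
    have hbφ : b ∈ LinearMap.range φ := by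
      rw [← hE.dualCoannihilator_dualAnnihilator (LinearMap.range φ)]
      exact dualAnnihilator_gc.monotone_u (OrderDual.toDual_le_toDual.mpr hker) hb
    obtain ⟨a, rfl⟩ := hbφ
    refine ⟨a, mem_dualCoannihilator.mpr fun f hf => ?_, rfl⟩
    obtain ⟨g, rfl⟩ := lcomp_surjective_of_injective hinj hφ f
    exact mem_dualCoannihilator.mp hb g hf

end InjectiveCogenerator

section Reflexivity

variable {R : Type u} [CommRing R] {E : Type u} [AddCommGroup E] [Module R E]

lemma biduality_surjective_pi (hEnd : Function.Surjective (LinearMap.lsmul R E)) (n : ℕ) :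
    Function.Surjective (biduality R E (Fin n → R)) := by
  intro Φ
  -- `coord t e` sends `x` to `x t • e`, so `Φ ∘ coord t` is an endomorphism of `E`.
  let coord (t : Fin n) : E →ₗ[R] MatlisDual R E (Fin n → R) :=
    LinearMap.lcomp R E (LinearMap.proj t) ∘ₗ (LinearMap.lsmul R E).flip
  choose r hr using fun t => hEnd (Φ ∘ₗ coord t)
  have hΦ (t : Fin n) (e : E) : Φ (coord t e) = r t • e := (LinearMap.congr_fun (hr t) e).symm
  refine ⟨r, LinearMap.ext fun f => ?_⟩
  have hf (x : Fin n → R) : f x = ∑ t, x t • f (Pi.single t 1) := by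
    conv_lhs => rw [pi_eq_sum_univ' x, map_sum]
    simp only [map_smul]
  have hfcoord : f = ∑ t, coord t (f (Pi.single t 1)) :=
    LinearMap.ext fun x => by rw [hf x, LinearMap.sum_apply]; rfl
  calc f r = ∑ t, r t • f (Pi.single t 1) := hf r
    _ = Φ (∑ t, coord t (f (Pi.single t 1))) := by simp only [map_sum, hΦ]
    _ = Φ f := by rw [← hfcoord]

lemma biduality_surjective_of_surjective (hE : Module.Injective R E) {M N : Type u}
    [AddCommGroup M] [Module R M] [AddCommGroup N] [Module R N] {p : M →ₗ[R] N}
    (hp : Function.Surjective p) (hM : Function.Surjective (biduality R E M)) :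
    Function.Surjective (biduality R E N) := by
  have hpp : Function.Surjective (LinearMap.lcomp R E (LinearMap.lcomp R E p)) :=
    lcomp_surjective_of_injective hE (LinearMap.lcomp_injective_of_surjective p hp)
  have hnat : biduality R E N ∘ₗ p =
      LinearMap.lcomp R E (LinearMap.lcomp R E p) ∘ₗ biduality R E M := rfl
  refine Function.Surjective.of_comp (g := p) ?_
  rw [← LinearMap.coe_comp, hnat]
  exact hpp.comp hM

lemma biduality_surjective_of_finite (hE : Module.Injective R E)
    (hEnd : Function.Surjective (LinearMap.lsmul R E)) (M : Type u) [AddCommGroup M] [Module R M]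
    [Module.Finite R M] : Function.Surjective (biduality R E M) := by
  obtain ⟨n, p, hp⟩ := Module.Finite.exists_fin' R M
  exact biduality_surjective_of_surjective hE hp (biduality_surjective_pi hEnd n)

lemma IsCogenerator.biduality_surjective_of_dual (hE : IsCogenerator R E) {A : Type u}
    [AddCommGroup A] [Module R A]
    (hA : Function.Surjective (biduality R E (MatlisDual R E A))) :
    Function.Surjective (biduality R E A) := by
  have hker : dualAnnihilator E (LinearMap.range (biduality R E A)) = ⊥ := by
    rw [eq_bot_iff]
    intro Φ hΦ
    obtain ⟨f, rfl⟩ := hA Φ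
    have hf : f = 0 := LinearMap.ext fun a => mem_dualAnnihilator.mp hΦ _ ⟨a, rfl⟩
    exact hf ▸ map_zero _
  rw [← LinearMap.range_eq_top, ← hE.dualCoannihilator_dualAnnihilator (LinearMap.range _), hker]
  exact eq_top_iff.mpr fun _ _ => mem_dualCoannihilator.mpr <| by simp

end Reflexivity

section Torsion

variable {R : Type u} [CommRing R] {A : Type u} [AddCommGroup A] [Module R A]

lemma mem_colonSubmodule_bot_iff {I : Ideal R} {a : A} :
    a ∈ colonSubmodule (⊥ : Submodule R A) I ↔ I • Submodule.span R {a} = ⊥ := by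
  rw [eq_bot_iff, Submodule.smul_le]
  refine forall₂_congr fun r _ => ⟨fun hra x hx => ?_, fun h => ?_⟩
  · obtain ⟨s, rfl⟩ := Submodule.mem_span_singleton.mp hx
    exact smul_comm r s a ▸ Submodule.smul_mem _ s hra
  · exact h a (Submodule.mem_span_singleton_self a)

lemma isHausdorff_dual {I : Ideal R}
    (hA : ∀ a : A, ∃ n, a ∈ colonSubmodule (⊥ : Submodule R A) (I ^ n))
    (E : Type u) [AddCommGroup E] [Module R E] : IsHausdorff I (MatlisDual R E A) where
  haus' f hf := by
    ext a
    obtain ⟨n, hn⟩ := hA a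
    exact vanish_of_mem_ideal_smul_top _ f (SModEq.zero.mp (hf n)) a hn

lemma iInf_pow_smul_eq_bot_of_fg [IsNoetherianRing R] [IsLocalRing R] {I : Ideal R} (hI : I ≠ ⊤)
    {N : Submodule R A} (hN : N.FG) : ⨅ n : ℕ, I ^ n • N = ⊥ := by
  have : Module.Finite R N := Module.Finite.of_fg hN
  calc ⨅ n : ℕ, I ^ n • N
      = ⨅ n : ℕ, (I ^ n • (⊤ : Submodule R N)).map N.subtype := by
        simp only [Submodule.map_smul'', Submodule.map_subtype_top]
    _ = (⨅ n : ℕ, I ^ n • (⊤ : Submodule R N)).map N.subtype :=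
        (Submodule.map_iInf _ N.injective_subtype).symm
    _ = ⊥ := by rw [Ideal.iInf_pow_smul_eq_bot_of_isLocalRing I hI, Submodule.map_bot]

end Torsion

section InjectiveHull

variable {R : Type u} [CommRing R] [IsLocalRing R] {E : Type u} [AddCommGroup E] [Module R E]
  {j : ResidueField R →ₗ[R] E}

lemma range_eq_span_map_one (j : ResidueField R →ₗ[R] E) :
    LinearMap.range j = Submodule.span R {j 1} := by
  have htop : Submodule.span R {(1 : ResidueField R)} = ⊤ :=
    eq_top_iff.mpr fun x _ => Submodule.mem_span_singleton.mpr <| by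
      obtain ⟨r, rfl⟩ := residue_surjective x
      exact ⟨r, (Algebra.algebraMap_eq_smul_one r).symm⟩
  rw [LinearMap.range_eq_map, ← htop, Submodule.map_span, Set.image_singleton]

lemma map_one_mem_socle (j : ResidueField R →ₗ[R] E) :
    j 1 ∈ colonSubmodule (⊥ : Submodule R E) (maximalIdeal R) := fun r hr => by
  have hr0 : r • (1 : ResidueField R) = 0 := by
    rw [← Algebra.algebraMap_eq_smul_one]
    exact (residue_eq_zero_iff r).mpr hr
  rw [← map_smul, hr0, map_zero]
  exact zero_mem _

lemma isCogenerator_of_residueField_injective (hE : Module.Injective R E)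
    (hj : Function.Injective j) : IsCogenerator R E := by
  intro M _ _ x hx
  let g : R →ₗ[R] E := LinearMap.toSpanSingleton R E (j 1)
  have hker : LinearMap.ker (LinearMap.toSpanSingleton R M x) ≤ LinearMap.ker g := by
    intro r hr
    have hrm : r ∈ maximalIdeal R := by
      by_contra hr'
      exact hx ((notMem_maximalIdeal.mp hr').smul_eq_zero.mp hr)
    exact map_one_mem_socle j r hrm
  obtain ⟨f, hf⟩ := exists_comp_eq_of_ker_le hE hker
  have hfx : f x = j 1 := by simpa [g] using LinearMap.congr_fun hf 1
  exact ⟨f, hfx.trans_ne <| (map_ne_zero_iff j hj).mpr one_ne_zero⟩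

namespace IsInjectiveHull

lemma isCogenerator (hj : IsInjectiveHull j) : IsCogenerator R E :=
  isCogenerator_of_residueField_injective hj.injectiveModule hj.injective

lemma map_one_ne_zero (hj : IsInjectiveHull j) : j 1 ≠ 0 :=
  (map_ne_zero_iff j hj.injective).mpr one_ne_zero

lemma map_one_mem (hj : IsInjectiveHull j) {S : Submodule R E} (hS : S ≠ ⊥) : j 1 ∈ S := by
  obtain ⟨_, ⟨hyS, hy⟩, hy0⟩ :=
    Submodule.exists_mem_ne_zero_of_ne_bot (mt (hj.essential _) hS)
  rw [range_eq_span_map_one] at hy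
  obtain ⟨r, rfl⟩ := Submodule.mem_span_singleton.mp hy
  have hr : r ∉ maximalIdeal R := fun hr => hy0 (map_one_mem_socle j r hr)
  exact (Submodule.smul_mem_iff_of_isUnit S (notMem_maximalIdeal.mp hr)).mp hyS

lemma socle_eq_span (hj : IsInjectiveHull j) :
    colonSubmodule (⊥ : Submodule R E) (maximalIdeal R) = Submodule.span R {j 1} := by
  refine le_antisymm (fun x hx => ?_) <|
    (Submodule.span_singleton_le_iff_mem _ _).mpr (map_one_mem_socle j)
  obtain rfl | hx0 := eq_or_ne x 0
  · exact zero_mem _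
  obtain ⟨r, hr⟩ := Submodule.mem_span_singleton.mp
    (hj.map_one_mem (mt Submodule.span_singleton_eq_bot.mp hx0))
  have hrm : r ∉ maximalIdeal R := fun h => hj.map_one_ne_zero (hr.symm.trans (hx r h))
  rw [← Submodule.smul_mem_iff_of_isUnit _ (notMem_maximalIdeal.mp hrm), hr]
  exact Submodule.mem_span_singleton_self _

variable [IsNoetherianRing R]

lemma exists_pow_mem_colon (hj : IsInjectiveHull j) (e : E) :
    ∃ n, e ∈ colonSubmodule (⊥ : Submodule R E) (maximalIdeal R ^ n) := by
  by_contra! h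
  have hmem : j 1 ∈ ⨅ n : ℕ, maximalIdeal R ^ n • Submodule.span R {e} :=
    Submodule.mem_iInf _ |>.mpr fun n => hj.map_one_mem (mt mem_colonSubmodule_bot_iff.mpr (h n))
  rw [iInf_pow_smul_eq_bot_of_fg (Ideal.IsPrime.ne_top inferInstance)
    (Submodule.fg_span_singleton e)] at hmem
  exact hj.map_one_ne_zero hmem

lemma exists_sub_lsmul_mem (hj : IsInjectiveHull j) (f : E →ₗ[R] E) :
    ∃ r : R, LinearMap.lsmul R E r - f ∈ maximalIdeal R • (⊤ : Submodule R (E →ₗ[R] E)) := by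
  have hf : f (j 1) ∈ Submodule.span R {j 1} := by
    rw [← hj.socle_eq_span]
    intro s hs
    have hs0 : s • j 1 = 0 := map_one_mem_socle j s hs
    rw [← map_smul, hs0, map_zero]
    exact zero_mem _
  obtain ⟨r, hr⟩ := Submodule.mem_span_singleton.mp hf
  refine ⟨r, mem_ideal_smul_top_of_vanish hj.injectiveModule _ _ fun a ha => ?_⟩
  rw [hj.socle_eq_span] at ha
  obtain ⟨s, rfl⟩ := Submodule.mem_span_singleton.mp ha
  simp [hr]

variable [IsAdicComplete (maximalIdeal R) R]

lemma lsmul_surjective (hj : IsInjectiveHull j) : Function.Surjective (LinearMap.lsmul R E) := by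
  have := isHausdorff_dual hj.exists_pow_mem_colon E
  refine surjective_of_mkQ_comp_surjective (I := maximalIdeal R) fun y => ?_
  obtain ⟨f, rfl⟩ := Submodule.mkQ_surjective _ y
  obtain ⟨r, hr⟩ := hj.exists_sub_lsmul_mem f
  exact ⟨r, (Submodule.Quotient.eq _).mpr hr⟩

/-- Matlis reflexivity of a finitely generated module, as an isomorphism onto its bidual. -/
noncomputable def bidualityEquiv (hj : IsInjectiveHull j) (M : Type u) [AddCommGroup M]
    [Module R M] [Module.Finite R M] : M ≃ₗ[R] MatlisDual R E (MatlisDual R E M) :=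
  LinearEquiv.ofBijective (biduality R E M) ⟨hj.isCogenerator.biduality_injective,
    biduality_surjective_of_finite hj.injectiveModule hj.lsmul_surjective M⟩

lemma isArtinian_matlisDual (hj : IsInjectiveHull j) (M : Type u) [AddCommGroup M] [Module R M]
    [Module.Finite R M] : IsArtinian R (MatlisDual R E M) :=
  have : IsNoetherian R (MatlisDual R E (MatlisDual R E M)) :=
    isNoetherian_of_linearEquiv (hj.bidualityEquiv M)
  hj.isCogenerator.isArtinian_of_isNoetherian_dual

lemma biduality_surjective_of_isArtinian (hj : IsInjectiveHull j) (A : Type u) [AddCommGroup A]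
    [Module R A] [IsArtinian R A] : Function.Surjective (biduality R E A) :=
  have := finite_matlisDual hj A
  hj.isCogenerator.biduality_surjective_of_dual
    (biduality_surjective_of_finite hj.injectiveModule hj.lsmul_surjective _)

end IsInjectiveHull

end InjectiveHull

section NakayamaAtZero

variable {R : Type u} [CommRing R] {c : ClosureOperation R} {M P : Type u}
  [AddCommGroup M] [Module R M] [Module.Finite R M]
  [AddCommGroup P] [Module R P] [Module.Finite R P]

lemma ClosureOperation.IsResidual.cl_comap (hc : c.IsResidual) {q : M →ₗ[R] P}
    (hq : Function.Surjective q) (S : Submodule R P) :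
    c.cl M (S.comap q) = (c.cl P S).comap q :=
  calc c.cl M (S.comap q)
      = c.cl M (LinearMap.ker (S.mkQ ∘ₗ q)) := by rw [LinearMap.ker_comp, Submodule.ker_mkQ]
    _ = ((c.cl (P ⧸ S) ⊥).comap S.mkQ).comap q := hc _ _ _ (S.mkQ_surjective.comp hq)
    _ = (c.cl P S).comap q := by rw [← hc _ _ _ S.mkQ_surjective, Submodule.ker_mkQ]

/-- The case `L = 0` of the Nakayama property of a closure operation, for the submodules of one
module `M`. -/
def ClosureOperation.IsNakayamaAtZero [IsLocalRing R] (c : ClosureOperation R) (M : Type u)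
    [AddCommGroup M] [Module R M] [Module.Finite R M] : Prop :=
  ∀ N : Submodule R M, N ≤ c.cl M (maximalIdeal R • N) → c.cl M ⊥ = c.cl M N

variable [IsLocalRing R]

lemma ClosureOperation.IsResidual.cl_ker_eq_cl (hc : c.IsResidual) {q : M →ₗ[R] P}
    (hq : Function.Surjective q) (hP : c.IsNakayamaAtZero P) {N : Submodule R M}
    (hqN : LinearMap.ker q ≤ N) (hN : N ≤ c.cl M (LinearMap.ker q ⊔ maximalIdeal R • N)) :
    c.cl M (LinearMap.ker q) = c.cl M N := by
  have hNq : (N.map q).comap q = N := by rw [Submodule.comap_map_eq, sup_eq_left.mpr hqN]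
  have hmNq : (maximalIdeal R • N.map q).comap q = LinearMap.ker q ⊔ maximalIdeal R • N := by
    rw [← Submodule.map_smul'', Submodule.comap_map_eq, sup_comm]
  have hNP : N.map q ≤ c.cl P (maximalIdeal R • N.map q) := by
    rwa [Submodule.map_le_iff_le_comap, ← hc.cl_comap hq, hmNq]
  rw [hc M P q hq, hP _ hNP, ← hc.cl_comap hq, hNq]

lemma ClosureOperation.IsResidual.isNakayama_iff (hc : c.IsResidual) :
    c.IsNakayama ↔ ∀ (M : Type u) [AddCommGroup M] [Module R M] [Module.Finite R M],
      c.IsNakayamaAtZero M := by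
  constructor
  · intro h M _ _ _ N hN
    exact h M ⊥ N bot_le (by rwa [bot_sup_eq])
  · intro h M _ _ _ L N hLN hN
    rw [← L.ker_mkQ] at hLN hN ⊢
    exact hc.cl_ker_eq_cl L.mkQ_surjective (h (M ⧸ L)) hLN hN

lemma ClosureOperation.IsResidual.isNakayamaAtZero_of_equiv (hc : c.IsResidual) (e : M ≃ₗ[R] P)
    (hP : c.IsNakayamaAtZero P) : c.IsNakayamaAtZero M := by
  intro N hN
  have hker : LinearMap.ker e.toLinearMap = ⊥ := e.ker
  rw [← hker]
  exact hc.cl_ker_eq_cl e.surjective hP (hker.trans_le bot_le) (by rwa [hker, bot_sup_eq])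

end NakayamaAtZero

section DualInterior

variable {R : Type u} [CommRing R] [IsLocalRing R] [IsNoetherianRing R]
  [IsAdicComplete (maximalIdeal R) R] {E : Type u} [AddCommGroup E] [Module R E]
  {j : ResidueField R →ₗ[R] E} (hj : IsInjectiveHull j) {c : ClosureOperation R}

lemma dualInterior_eq_dualCoannihilator (c : ClosureOperation R) (A : Type u) [AddCommGroup A]
    [Module R A] [IsArtinian R A] [Module.Finite R (MatlisDual R E A)] :
    dualInterior hj c A = dualCoannihilator (c.cl (MatlisDual R E A) ⊥) :=
  congrArg (Submodule.comap (biduality R E A)) (range_lcomp_mkQ _)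

variable {A B : Type u} [AddCommGroup A] [Module R A] [IsArtinian R A] [AddCommGroup B]
  [Module R B] [Module.Finite R (MatlisDual R E B)]

lemma map_dualInterior (hc : c.IsResidual) {φ : A →ₗ[R] B} (hφ : Function.Injective φ) :
    (dualInterior hj c A).map φ =
      dualCoannihilator (c.cl (MatlisDual R E B) (dualAnnihilator E (LinearMap.range φ))) := by
  have := finite_matlisDual hj A
  rw [dualInterior_eq_dualCoannihilator,
    hj.isCogenerator.map_dualCoannihilator hj.injectiveModule hφ,
    ← hc _ _ _ (lcomp_surjective_of_injective hj.injectiveModule hφ), dualAnnihilator_range]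

variable [IsArtinian R B]

lemma map_subtype_dualInterior_dualCoannihilator (hc : c.IsResidual)
    (Z : Submodule R (MatlisDual R E B)) :
    (dualInterior hj c (dualCoannihilator Z)).map (dualCoannihilator Z).subtype =
      dualCoannihilator (c.cl (MatlisDual R E B) Z) := by
  rw [map_dualInterior hj hc (Submodule.injective_subtype _), Submodule.range_subtype,
    hj.isCogenerator.dualAnnihilator_dualCoannihilator (hj.biduality_surjective_of_isArtinian B)]

lemma isInterior_dualInterior (hc : c.IsResidual) : (dualInterior hj c).IsInterior where
  map_equiv M N _ _ _ _ _ _ φ := by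
    have := finite_matlisDual hj N
    have hker : dualAnnihilator E (LinearMap.range φ.toLinearMap) = ⊥ := by
      rw [dualAnnihilator_range]
      exact LinearMap.ker_eq_bot.mpr (LinearMap.lcomp_injective_of_surjective _ φ.surjective)
    rw [map_dualInterior hj hc φ.injective, dualInterior_eq_dualCoannihilator, hker]
  mono M _ _ _ L := by
    have := finite_matlisDual hj M
    rw [map_dualInterior hj hc L.injective_subtype, dualInterior_eq_dualCoannihilator]
    exact dualAnnihilator_gc.monotone_u (OrderDual.toDual_le_toDual.mpr (c.mono _ _ _ bot_le))
  idempotent M _ _ _ := by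
    have := finite_matlisDual hj M
    rw [dualInterior_eq_dualCoannihilator, map_subtype_dualInterior_dualCoannihilator hj hc,
      c.idempotent]

lemma nakayama_dualInterior_iff (hc : c.IsResidual) (Z : Submodule R (MatlisDual R E B)) :
    ((dualInterior hj c (colonSubmodule (dualCoannihilator Z) (maximalIdeal R))).map
        (colonSubmodule (dualCoannihilator Z) (maximalIdeal R)).subtype ≤ dualCoannihilator Z →
      (dualInterior hj c (dualCoannihilator Z)).map (dualCoannihilator Z).subtype =
        dualInterior hj c B) ↔
    (Z ≤ c.cl _ (maximalIdeal R • Z) → c.cl _ ⊥ = c.cl _ Z) := by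
  have hle {Y Z : Submodule R (MatlisDual R E B)} :
      dualCoannihilator Y ≤ dualCoannihilator Z ↔ Z ≤ Y :=
    hj.isCogenerator.dualCoannihilator_le_iff (hj.biduality_surjective_of_isArtinian B)
  rw [← dualCoannihilator_smul, map_subtype_dualInterior_dualCoannihilator hj hc,
    map_subtype_dualInterior_dualCoannihilator hj hc, dualInterior_eq_dualCoannihilator, hle,
    le_antisymm_iff, le_antisymm_iff, hle, hle]

lemma isNakayama_dualInterior_iff (hc : c.IsResidual) : (dualInterior hj c).IsNakayama ↔
    ∀ (B : Type u) [AddCommGroup B] [Module R B] [IsArtinian R B]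
      [Module.Finite R (MatlisDual R E B)], c.IsNakayamaAtZero (MatlisDual R E B) := by
  constructor
  · intro h B _ _ _ _ Z
    exact (nakayama_dualInterior_iff hj hc Z).mp (h B (dualCoannihilator Z))
  · intro h B _ _ _ A
    have := finite_matlisDual hj B
    rw [← hj.isCogenerator.dualCoannihilator_dualAnnihilator A]
    exact (nakayama_dualInterior_iff hj hc _).mpr (h B _)

lemma isNakayama_iff_isNakayama_dualInterior (hc : c.IsResidual) :
    c.IsNakayama ↔ (dualInterior hj c).IsNakayama := by
  rw [hc.isNakayama_iff, isNakayama_dualInterior_iff hj hc]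
  refine ⟨fun h B _ _ _ _ => h _, fun h M _ _ _ => ?_⟩
  have := hj.isArtinian_matlisDual M
  have := finite_matlisDual hj (MatlisDual R E M)
  exact hc.isNakayamaAtZero_of_equiv (hj.bidualityEquiv M) (h (MatlisDual R E M))

end DualInterior

end ClosureInterior

theorem mainTheorem3 {R : Type u} [CommRing R] [IsLocalRing R] [IsNoetherianRing R]
    [IsAdicComplete (IsLocalRing.maximalIdeal R) R]
    {E : Type u} [AddCommGroup E] [Module R E]
    {j : IsLocalRing.ResidueField R →ₗ[R] E} (hj : ClosureInterior.IsInjectiveHull j)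
    (c : ClosureInterior.ClosureOperation R) (hc : c.IsResidual) :
    (ClosureInterior.dualInterior hj c).IsInterior ∧
      (c.IsNakayama ↔ (ClosureInterior.dualInterior hj c).IsNakayama) :=
  ⟨ClosureInterior.isInterior_dualInterior hj hc,
    ClosureInterior.isNakayama_iff_isNakayama_dualInterior hj hc⟩
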